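/- Theorem 3.2 (Information-theoretic Lower Bound). For integers $n,p\ge 1$, a contamination rate $\epsilon\in[0,1]$, a noise level $\sigma>0$, a vector $\beta\in\mathbb{R}^p$ and a conditional distribution (Markov kernel) $Q=(Q_x)_{x\in\mathbb{R}^p}$ on $\mathbb{R}$, let $\mathbb{P}_{\beta,\sigma,Q}$ denote the law of $n$ independent pairs $(X_1,y_1),\dots,(X_n,y_n)\in\mathbb{R}^p\times\mathbb{R}$ drawn from the adaptive contamination model $$X_i\sim\mathcal{N}(0,I_p),\qquad y_i\mid X_i\sim(1-\epsilon)\,\mathcal{N}(X_i^\top\beta,\sigma^2)+\epsilon\,Q_{X_i}.$$ There exists a universal constant $C>0$ such that, for all such $n,p,\epsilon,\sigma$, $$\inf_{\widehat\beta}\ \sup_{\beta,Q}\ \mathbb{P}_{\beta,\sigma,Q}\left(\|\widehat\beta-\beta\|_2\ge C\sigma\left(\sqrt{\frac{p}{n}}+\frac{\epsilon}{\sqrt{\log(n\epsilon^2/p+e)}}\right)\right)\ge\frac12,$$ where the infimum is over all estimators, i.e. measurable functions $\widehat\beta$ of the data $(X_i,y_i)_{i=1}^n$ with values in $\mathbb{R}^p$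 (which may depend on $n,p,\epsilon,\sigma$), and the supremum is over all $\beta\in\mathbb{R}^p$ and all conditional distributions $Q$. -/

import Mathlib

open MeasureTheory ProbabilityTheory

/-- The conditional law of a response `y` given the covariate `x`, under adaptive contamination of
the responses: `(1 - ε) N(xᵀβ, σ²) + ε Q_x`, as a kernel in `x`. -/
noncomputable def responseKernel {p : ℕ} (ε σ : ℝ) (β : EuclideanSpace ℝ (Fin p))
    (Q : Kernel (EuclideanSpace ℝ (Fin p)) ℝ) : Kernel (EuclideanSpace ℝ (Fin p)) ℝ where
  toFun x := ENNReal.ofReal (1 - ε) • gaussianReal (inner ℝ x β) (σ ^ 2).toNNReal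
    + ENNReal.ofReal ε • Q x
  measurable' := by
    refine Measure.measurable_of_measurable_coe _ fun s hs => ?_
    have hG : Measurable fun x : EuclideanSpace ℝ (Fin p) =>
        gaussianReal (inner ℝ x β) (σ ^ 2).toNNReal s := by
      have h (x : EuclideanSpace ℝ (Fin p)) :
          gaussianReal (inner ℝ x β) (σ ^ 2).toNNReal s
            = gaussianReal 0 (σ ^ 2).toNNReal
                (Prod.mk x ⁻¹' {z : EuclideanSpace ℝ (Fin p) × ℝ | z.2 + inner ℝ z.1 β ∈ s}) := by
        have hm := gaussianReal_map_add_const (μ := 0) (v := (σ ^ 2).toNNReal) (inner ℝ x β)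
        rw [zero_add] at hm
        rw [← hm, Measure.map_apply (by fun_prop) hs]
        rfl
      simp_rw [h]
      have hf : Measurable fun z : EuclideanSpace ℝ (Fin p) × ℝ => z.2 + inner ℝ z.1 β := by
        fun_prop
      exact measurable_measure_prodMk_left (hf hs)
    simp only [Measure.add_apply, Measure.smul_apply, smul_eq_mul]
    exact (hG.const_mul _).add ((Q.measurable_coe hs).const_mul _)

/-- The law of one observation `(X, y)`: `X ∼ N(0, I_p)` and
`y ∣ X ∼ (1 - ε) N(Xᵀβ, σ²) + ε Q_X`. -/
noncomputable def observationLaw {p : ℕ} (ε σ : ℝ) (β : EuclideanSpace ℝ (Fin p))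
    (Q : Kernel (EuclideanSpace ℝ (Fin p)) ℝ) : Measure (EuclideanSpace ℝ (Fin p) × ℝ) :=
  stdGaussian (EuclideanSpace ℝ (Fin p)) ⊗ₘ responseKernel ε σ β Q

/-- The law of the data set `(X₁, y₁), …, (Xₙ, yₙ)` of `n` independent observations. -/
noncomputable def dataLaw {p : ℕ} (n : ℕ) (ε σ : ℝ) (β : EuclideanSpace ℝ (Fin p))
    (Q : Kernel (EuclideanSpace ℝ (Fin p)) ℝ) :
    Measure (Fin n → EuclideanSpace ℝ (Fin p) × ℝ) :=
  Measure.pi fun _ => observationLaw ε σ β Q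

/-- The rate `σ (√(p / n) + ε / √(log (n ε² / p + e)))`. -/
noncomputable def minimaxRate (n p : ℕ) (ε σ : ℝ) : ℝ :=
  σ * (√((p : ℝ) / n) + ε / √(Real.log (n * ε ^ 2 / p + Real.exp 1)))

/-! The adversary makes the responses look as if they did not depend on `β`. Put `v = σ²` and `b =
α/σ` with `α ≤ ε/6`. When `|m| < σα`, the density of `N(m, v)` relative to the law `G ∝ e^{b|y|}
N(0, v)` is at most the normalising constant `M ≤ 1 + ε`. Hence `G` dominates `(1 - ε) N(m, v)`, and
contamination can turn `N(m, v)` into `G` exactly (`exists_contamination`,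
`exists_responseKernel_eq_hiddenResponse`). Only covariates with `|xᵀβ| ≥ σα` still carry
information about `β`.

At those covariates the relative entropy to `G` is at most `5 m²/v` (`integral_logRatio_le`), so `n`
observations carry at most `5n/σ²` times the truncated second moment of `xᵀβ`. This is at most `5p`
on a ball of radius `R`, where either `R = σ√(p/n)` with `α = 0`, or `R` is of order `σε/√log(nε²/p
+ e)` with `α = ε/6`, by a Gaussian tail bound.

Under the common law, which does not see `β`, a volume argument gives a centre in the ball that the
estimator approaches within `e⁻¹²R` with probability at most `e^{-12p}`
(`exists_norm_le_measure_near_le`). An entropy budget of `5p` cannot raise this above one half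
(`exists_dataLaw_error_ge`). -/

/-! ### Change of measure and the volume argument. -/

/-- Change of measure: if `ν = e^{-L} μ` then `μ(A)` is controlled by `ν(A)` and by the relative
entropy `∫ L dμ`. -/
lemma mul_measureReal_le_of_withDensity {Ω : Type*} [MeasurableSpace Ω] {μ ν : Measure Ω}
    [IsProbabilityMeasure μ] [IsProbabilityMeasure ν] {L : Ω → ℝ} (hL : Measurable L)
    (hLi : Integrable L μ) (hν : μ.withDensity (fun ω => ENNReal.ofReal (Real.exp (-L ω))) = ν)
    {A : Set Ω} (hA : MeasurableSet A) (t : ℝ) :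
    t * μ.real A ≤ ∫ ω, L ω ∂μ + Real.exp t * ν.real A := by
  classical
  let g : Ω → ℝ := fun ω => Real.exp (A.indicator (fun _ => t) ω)
  have hg : g = fun ω => A.indicator (fun _ => Real.exp t - 1) ω + 1 := by
    funext ω
    by_cases h : ω ∈ A <;> simp [g, h]
  have hgi : Integrable g ν := by
    rw [hg]
    exact ((integrable_const _).indicator hA).add (integrable_const _)
  have hgν : ∫ ω, g ω ∂ν = (Real.exp t - 1) * ν.real A + 1 := by
    rw [hg, integral_add ((integrable_const _).indicator hA) (integrable_const _),
      integral_indicator_const _ hA]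
    simp [mul_comm]
  have hd : Measurable fun ω => Real.toNNReal (Real.exp (-L ω)) := by fun_prop
  have hν' : ν = μ.withDensity (fun ω => ((Real.toNNReal (Real.exp (-L ω)) : NNReal) : ENNReal)) :=
    hν.symm
  have hgμ : Integrable (fun ω => Real.exp (-L ω) * g ω) μ := by
    have := hgi
    rw [hν', integrable_withDensity_iff_integrable_smul hd] at this
    refine this.congr (.of_forall fun ω => ?_)
    simp [NNReal.smul_def, (Real.exp_pos _).le]
  have hgμ' : ∫ ω, Real.exp (-L ω) * g ω ∂μ = ∫ ω, g ω ∂ν := by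
    rw [hν', integral_withDensity_eq_integral_smul hd]
    refine integral_congr_ae (.of_forall fun ω => ?_)
    simp [NNReal.smul_def, (Real.exp_pos _).le]
  -- Integrate `1 + x ≤ e^x` at `x = t·1_A - L`; the exponential side is an integral under `ν`,
  -- equal to `1 + (e^t - 1) ν(A)`.
  have key : ∫ ω, A.indicator (fun _ => t) ω ∂μ
      ≤ ∫ ω, (L ω + (Real.exp (-L ω) * g ω - 1)) ∂μ := by
    refine integral_mono ((integrable_const _).indicator hA)
      (hLi.add (hgμ.sub (integrable_const _))) fun ω => ?_
    have := Real.add_one_le_exp (A.indicator (fun _ => t) ω - L ω)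
    have e : Real.exp (A.indicator (fun _ => t) ω - L ω) = Real.exp (-L ω) * g ω := by
      rw [← Real.exp_add]; ring_nf
    rw [e] at this
    linarith
  rw [integral_indicator_const _ hA,
    integral_add (g := fun ω => Real.exp (-L ω) * g ω - 1) hLi (hgμ.sub (integrable_const _)),
    integral_sub hgμ (integrable_const _), hgμ', hgν] at key
  have h0 : 0 ≤ ν.real A := measureReal_nonneg
  simp only [smul_eq_mul, integral_const, probReal_univ, mul_one] at key
  nlinarith

lemma pi_withDensity_exp {ι Ω : Type*} [Fintype ι] [MeasurableSpace Ω] {μ ν : Measure Ω}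
    [IsProbabilityMeasure μ] [IsProbabilityMeasure ν] {L : Ω → ℝ} (hL : Measurable L)
    (hν : μ.withDensity (fun ω => ENNReal.ofReal (Real.exp (-L ω))) = ν) :
    (Measure.pi fun _ : ι => μ).withDensity
        (fun D => ENNReal.ofReal (Real.exp (-∑ i, L (D i)))) = Measure.pi fun _ : ι => ν := by
  refine (Measure.pi_eq fun s hs => ?_).symm
  have hf (i : ι) : Measurable ((s i).indicator fun ω => ENNReal.ofReal (Real.exp (-L ω))) :=
    Measurable.indicator (by fun_prop) (hs i)
  have hind : iIndepFun (fun (i : ι) (D : ι → Ω) =>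
      (s i).indicator (fun ω => ENNReal.ofReal (Real.exp (-L ω))) (D i))
      (Measure.pi fun _ : ι => μ) := iIndepFun_pi fun i => (hf i).aemeasurable
  -- On a box the density factorises over coordinates, so independence splits the integral.
  have hprod (D : ι → Ω) : (Set.univ.pi s).indicator
        (fun D => ENNReal.ofReal (Real.exp (-∑ i, L (D i)))) D
      = ∏ i, (s i).indicator (fun ω => ENNReal.ofReal (Real.exp (-L ω))) (D i) := by
    by_cases h : ∀ i, D i ∈ s i
    · rw [Set.indicator_of_mem (by simpa using h), ← Finset.sum_neg_distrib, Real.exp_sum,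
        ENNReal.ofReal_prod_of_nonneg fun i _ => (Real.exp_pos _).le]
      exact Finset.prod_congr rfl fun i _ => by rw [Set.indicator_of_mem (h i)]
    · rw [Set.indicator_of_notMem (by simpa using h)]
      obtain ⟨i, hi⟩ := not_forall.1 h
      rw [Finset.prod_eq_zero (Finset.mem_univ i) (Set.indicator_of_notMem hi _)]
  rw [withDensity_apply _ (MeasurableSet.univ_pi hs), ← lintegral_indicator (.univ_pi hs)]
  simp_rw [hprod]
  rw [lintegral_prod_eq_prod_lintegral_of_indepFun Finset.univ _ hind
    fun i => (hf i).comp (measurable_pi_apply i)]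
  refine Finset.prod_congr rfl fun i _ => ?_
  rw [(measurePreserving_eval (fun _ : ι => μ) i).lintegral_comp (hf i), lintegral_indicator (hs i),
    ← withDensity_apply _ (hs i), hν]

/-- Tensorised change of measure for `n` independent observations. -/
lemma mul_measureReal_pi_le_of_withDensity {Ω : Type*} [MeasurableSpace Ω] {μ ν : Measure Ω}
    [IsProbabilityMeasure μ] [IsProbabilityMeasure ν] {L : Ω → ℝ} (hL : Measurable L)
    (hLi : Integrable L μ) (hν : μ.withDensity (fun ω => ENNReal.ofReal (Real.exp (-L ω))) = ν)
    (n : ℕ) {A : Set (Fin n → Ω)} (hA : MeasurableSet A) (t : ℝ) :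
    t * (Measure.pi fun _ => μ).real A
      ≤ n * ∫ ω, L ω ∂μ + Real.exp t * (Measure.pi fun _ => ν).real A := by
  have hi (i : Fin n) : Integrable (fun D : Fin n → Ω => L (D i)) (Measure.pi fun _ => μ) :=
    integrable_comp_eval hLi
  have h := mul_measureReal_le_of_withDensity (L := fun D : Fin n → Ω => ∑ i, L (D i))
    (by fun_prop) (integrable_finsetSum _ fun i _ => hi i) (pi_withDensity_exp hL hν) hA t
  have he : ∫ D : Fin n → Ω, ∑ i, L (D i) ∂(Measure.pi fun _ => μ) = n * ∫ ω, L ω ∂μ := by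
    rw [integral_finsetSum _ fun i _ => hi i]
    simp_rw [integral_comp_eval (μ := fun _ : Fin n => μ) hLi.aestronglyMeasurable]
    simp
  rwa [he] at h

/-- For a random point `Z`, some centre in the ball of radius `R` is within `r` of `Z` with
probability at most the ratio of volumes. -/
lemma exists_norm_le_measure_near_le {Ω : Type*} [MeasurableSpace Ω] (ν : Measure Ω)
    [IsProbabilityMeasure ν] {E : Type*} [NormedAddCommGroup E] [NormedSpace ℝ E]
    [FiniteDimensional ℝ E] [MeasurableSpace E] [BorelSpace E] {Z : Ω → E} (hZ : Measurable Z)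
    {r R : ℝ} (hr : 0 < r) (hR : 0 < R) :
    ∃ β : E, ‖β‖ ≤ R ∧ ν.real {ω | ‖Z ω - β‖ < r} ≤ (r / R) ^ Module.finrank ℝ E := by
  let m : Measure E := Measure.addHaar
  by_contra! hcon
  set d := Module.finrank ℝ E
  have hmeas : MeasurableSet {z : E × Ω | ‖Z z.2 - z.1‖ < r} :=
    measurableSet_lt (by fun_prop) measurable_const
  -- By Fubini, integrating over centres gives the volume of an `r`-ball; if every centre in the
  -- `R`-ball exceeded the ratio, the integral would be strictly larger.
  have hup : ∫⁻ β in Metric.ball (0 : E) R, ν {ω | ‖Z ω - β‖ < r} ∂m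
      ≤ ENNReal.ofReal (r ^ d) * m (Metric.ball (0 : E) 1) := by
    calc ∫⁻ β in Metric.ball (0 : E) R, ν {ω | ‖Z ω - β‖ < r} ∂m
        ≤ ∫⁻ β, ν {ω | ‖Z ω - β‖ < r} ∂m := setLIntegral_le_lintegral _ _
      _ = (m.prod ν) {z : E × Ω | ‖Z z.2 - z.1‖ < r} := by rw [Measure.prod_apply hmeas]; rfl
      _ = ∫⁻ ω, m (Metric.ball (Z ω) r) ∂ν := by
          rw [Measure.prod_apply_symm hmeas]
          refine lintegral_congr fun ω => congrArg m ?_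
          ext β
          simp [dist_eq_norm, norm_sub_rev]
      _ = ENNReal.ofReal (r ^ d) * m (Metric.ball (0 : E) 1) := by
          simp_rw [Measure.addHaar_ball_of_pos m _ hr]
          simp [d]
  have hlow : ENNReal.ofReal ((r / R) ^ d) * m (Metric.ball (0 : E) R)
      < ∫⁻ β in Metric.ball (0 : E) R, ν {ω | ‖Z ω - β‖ < r} ∂m := by
    rw [← setLIntegral_const]
    refine setLIntegral_strict_mono Metric.isOpen_ball.measurableSet
      (Metric.measure_ball_pos _ _ hR).ne' (measurable_measure_prodMk_left hmeas) ?_ ?_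
    · rw [setLIntegral_const]
      exact ENNReal.mul_ne_top ENNReal.ofReal_ne_top measure_ball_lt_top.ne
    · refine .of_forall fun β hβ => ?_
      rw [← ENNReal.ofReal_toReal (measure_ne_top ν _)]
      exact (ENNReal.ofReal_lt_ofReal_iff_of_nonneg (by positivity)).2
        (hcon β (mem_ball_zero_iff.1 hβ).le)
  rw [Measure.addHaar_ball_of_pos m _ hR, ← mul_assoc, ← ENNReal.ofReal_mul (by positivity),
    ← mul_pow, div_mul_cancel₀ _ hR.ne'] at hlow
  exact absurd hup hlow.not_ge

/-! ### Elementary exponential inequalities. -/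

lemma exp_mul_le_quadratic {α s : ℝ} (hα : 0 ≤ α) (hα1 : α ≤ 1) (hs : 0 ≤ s) :
    Real.exp (α * s) ≤ 1 + α * s + α ^ 2 * Real.exp s := by
  have hmono : MonotoneOn (fun s : ℝ => 1 + α * s + α ^ 2 * Real.exp s - Real.exp (α * s))
      (Set.Ici 0) := by
    have hd (x : ℝ) : HasDerivAt
        (fun s : ℝ => 1 + α * s + α ^ 2 * Real.exp s - Real.exp (α * s))
        (α * 1 + α ^ 2 * Real.exp x - Real.exp (α * x) * (α * 1)) x :=
      ((((hasDerivAt_id x).const_mul α).const_add 1).add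
        ((Real.hasDerivAt_exp x).const_mul _)).sub ((hasDerivAt_id x).const_mul α).exp
    refine monotoneOn_of_deriv_nonneg (convex_Ici 0)
      (fun x _ => (hd x).continuousAt.continuousWithinAt)
      (fun x _ => (hd x).differentiableAt.differentiableWithinAt) fun x _ => ?_
    rw [(hd x).deriv]
    -- Convexity between `0` and `x` gives `e^{αx} ≤ (1 - α) + α e^x`, hence a nonnegative
    -- derivative.
    have h := convexOn_exp.2 (Set.mem_univ (0 : ℝ)) (Set.mem_univ x)
      (sub_nonneg.2 hα1) hα (by ring)
    simp only [smul_eq_mul, mul_zero, zero_add, Real.exp_zero, mul_one] at h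
    nlinarith [mul_le_mul_of_nonneg_left h hα, sq_nonneg α]
  have := hmono Set.self_mem_Ici (Set.mem_Ici.2 hs) hs
  simp only [mul_zero, add_zero, Real.exp_zero, mul_one] at this
  nlinarith [sq_nonneg α]

lemma exp_abs_le (s : ℝ) : Real.exp |s| ≤ Real.exp s + Real.exp (-s) := by
  rcases abs_cases s with h | h <;> rw [h.1] <;> linarith [Real.exp_pos s, Real.exp_pos (-s)]

lemma exp_half_le_two : Real.exp (1 / 2) ≤ 2 := by
  have := Real.exp_one_lt_d9
  have h2 : Real.exp (1 / 2) ^ 2 = Real.exp 1 := by rw [← Real.exp_nat_mul]; norm_num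
  nlinarith [Real.exp_pos (1 / 2)]

/-! ### One-dimensional Gaussian moments and densities. -/

section gaussianReal

variable (m : ℝ) (v : NNReal)

lemma integrable_exp_mul_abs_gaussianReal {b : ℝ} (hb : 0 ≤ b) :
    Integrable (fun y => Real.exp (b * |y|)) (gaussianReal m v) := by
  refine ((integrable_exp_mul_gaussianReal b).add
    (integrable_exp_mul_gaussianReal (-b))).mono' (by fun_prop) (.of_forall fun y => ?_)
  rw [Real.norm_of_nonneg (Real.exp_pos _).le, ← abs_of_nonneg hb, ← abs_mul, abs_of_nonneg hb]
  simpa using exp_abs_le (b * y)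

lemma integral_exp_mul_abs_gaussianReal_le {b : ℝ} (hb : 0 ≤ b) :
    ∫ y, Real.exp (b * |y|) ∂gaussianReal 0 v ≤ 2 * Real.exp (v * b ^ 2 / 2) := by
  have h (c : ℝ) : ∫ y, Real.exp (c * y) ∂gaussianReal 0 v = Real.exp (v * c ^ 2 / 2) := by
    have := congrFun (mgf_id_gaussianReal (μ := 0) (v := v)) c
    simpa [mgf] using this
  calc ∫ y, Real.exp (b * |y|) ∂gaussianReal 0 v
      ≤ ∫ y, (Real.exp (b * y) + Real.exp (-b * y)) ∂gaussianReal 0 v := by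
        refine integral_mono (integrable_exp_mul_abs_gaussianReal 0 v hb)
          ((integrable_exp_mul_gaussianReal b).add (integrable_exp_mul_gaussianReal (-b)))
          fun y => ?_
        simpa [abs_mul, abs_of_nonneg hb] using exp_abs_le (b * y)
    _ = 2 * Real.exp (v * b ^ 2 / 2) := by
        rw [integral_add (integrable_exp_mul_gaussianReal b) (integrable_exp_mul_gaussianReal (-b)),
          h, h]
        ring_nf

lemma integrable_id_gaussianReal' : Integrable (fun y => y) (gaussianReal m v) :=
  (memLp_id_gaussianReal 1).integrable (by simp)

/-- The mean absolute value of a Gaussian variable is smallest when it is centred. -/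
lemma integral_abs_gaussianReal_zero_le :
    ∫ y, |y| ∂gaussianReal 0 v ≤ ∫ y, |y| ∂gaussianReal m v := by
  have hp : ∫ y, |y| ∂gaussianReal m v = ∫ y, |m + y| ∂gaussianReal 0 v := by
    have := gaussianReal_map_const_add (μ := 0) (v := v) m
    rw [zero_add] at this
    rw [← this, integral_map (by fun_prop) (by fun_prop)]
  have hm : ∫ y, |y| ∂gaussianReal m v = ∫ y, |m - y| ∂gaussianReal 0 v := by
    have := gaussianReal_map_const_sub (μ := 0) (v := v) m
    rw [sub_zero] at this
    rw [← this, integral_map (by fun_prop) (by fun_prop)]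
  have hi := integrable_id_gaussianReal' 0 v
  have hi1 : Integrable (fun y => |m + y|) (gaussianReal 0 v) := ((integrable_const m).add hi).abs
  have hi2 : Integrable (fun y => |m - y|) (gaussianReal 0 v) := ((integrable_const m).sub hi).abs
  -- Average `|m + y|` and `|m - y|`: by symmetry of the centred law both have the same mean.
  have : ∫ y, |y| ∂gaussianReal 0 v
      ≤ ∫ y, ((1 / 2) * |m + y| + (1 / 2) * |m - y|) ∂gaussianReal 0 v := by
    refine integral_mono hi.abs ((hi1.const_mul _).add (hi2.const_mul _)) fun y => ?_
    have := abs_sub (m + y) (m - y)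
    rw [show m + y - (m - y) = 2 * y by ring, abs_mul, abs_two] at this
    show |y| ≤ (1 / 2) * |m + y| + (1 / 2) * |m - y|
    linarith
  rw [integral_add (hi1.const_mul _) (hi2.const_mul _), integral_const_mul, integral_const_mul,
    ← hp, ← hm] at this
  linarith

variable {v} in
lemma gaussianReal_eq_withDensity (hv : v ≠ 0) :
    gaussianReal m v = (gaussianReal 0 v).withDensity
      (fun y => ENNReal.ofReal (Real.exp ((m * y - m ^ 2 / 2) / v))) := by
  rw [gaussianReal_of_var_ne_zero _ hv, gaussianReal_of_var_ne_zero _ hv,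
    ← withDensity_mul _ (by fun_prop) (by fun_prop)]
  congr 1
  funext y
  have hv' : (v : ℝ) ≠ 0 := by exact_mod_cast hv
  rw [Pi.mul_apply, gaussianPDF, gaussianPDF, ← ENNReal.ofReal_mul (gaussianPDFReal_nonneg _ _ _),
    gaussianPDFReal, gaussianPDFReal, mul_assoc _ (Real.exp _), ← Real.exp_add]
  congr 3
  field_simp
  ring

end gaussianReal

/-! ### The hiding law and its relative entropy. -/

/-- The normalising constant of the density `e^{b|y|}` with respect to `N(0, v)`. -/
noncomputable def expAbsMass (v : NNReal) (b : ℝ) : ℝ :=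
  ∫ y, Real.exp (b * |y|) ∂gaussianReal 0 v

/-- The common law `e^{b|y|} N(0, v) / M` that hides small regression means. -/
noncomputable def hidingLaw (v : NNReal) (b : ℝ) : Measure ℝ :=
  (gaussianReal 0 v).tilted fun y => b * |y|

/-- The log-density of `N(m, v)` with respect to `hidingLaw v b`. -/
noncomputable def logRatio (v : NNReal) (b m y : ℝ) : ℝ :=
  Real.log (expAbsMass v b) + (m * y - m ^ 2 / 2) / v - b * |y|

section hidingLaw

variable {v : NNReal} {b : ℝ}

lemma one_le_expAbsMass (hb : 0 ≤ b) : 1 ≤ expAbsMass v b := by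
  have : ∫ _, (1 : ℝ) ∂gaussianReal 0 v ≤ expAbsMass v b := by
    refine integral_mono (integrable_const _) (integrable_exp_mul_abs_gaussianReal 0 v hb)
      fun y => ?_
    exact Real.one_le_exp (by positivity)
  simpa using this

lemma isProbabilityMeasure_hidingLaw (hb : 0 ≤ b) : IsProbabilityMeasure (hidingLaw v b) :=
  isProbabilityMeasure_tilted (integrable_exp_mul_abs_gaussianReal 0 v hb)

lemma measurable_logRatio {Ω : Type*} [MeasurableSpace Ω] {f g : Ω → ℝ} (hf : Measurable f)
    (hg : Measurable g) : Measurable fun ω => logRatio v b (f ω) (g ω) := by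
  unfold logRatio
  fun_prop

lemma hidingLaw_withDensity (hv : v ≠ 0) (hb : 0 ≤ b) (m : ℝ) :
    (hidingLaw v b).withDensity (fun y => ENNReal.ofReal (Real.exp (logRatio v b m y)))
      = gaussianReal m v := by
  have hM : 0 < expAbsMass v b := one_pos.trans_le (one_le_expAbsMass hb)
  rw [hidingLaw, Measure.tilted, gaussianReal_eq_withDensity m hv,
    ← withDensity_mul _ (by fun_prop) (measurable_logRatio measurable_const measurable_id'
      |>.exp.ennreal_ofReal)]
  congr 1
  funext y
  rw [Pi.mul_apply, ← ENNReal.ofReal_mul (by positivity), ← expAbsMass, logRatio, add_sub_assoc,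
    Real.exp_add, Real.exp_log hM]
  congr 1
  rw [div_mul_eq_mul_div, mul_left_comm, mul_div_assoc, ← Real.exp_add, ← mul_div_assoc,
    mul_div_cancel_left₀ _ hM.ne']
  congr 1
  ring

lemma gaussianReal_withDensity_neg_logRatio (hv : v ≠ 0) (hb : 0 ≤ b) (m : ℝ) :
    (gaussianReal m v).withDensity (fun y => ENNReal.ofReal (Real.exp (-logRatio v b m y)))
      = hidingLaw v b := by
  have hm := measurable_logRatio (v := v) (b := b) (measurable_const (a := m)) measurable_id'
  rw [← hidingLaw_withDensity hv hb m,
    ← withDensity_mul _ hm.exp.ennreal_ofReal hm.fun_neg.exp.ennreal_ofReal]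
  convert withDensity_one
  funext y
  simp [← ENNReal.ofReal_mul (Real.exp_pos _).le, ← Real.exp_add]

/-- The first-order term is kept exact because it has to cancel against `-b E|y|` in the relative
entropy; only the remainder is bounded crudely, with `4 ≥ 2e^{1/2}`. -/
lemma expAbsMass_le {σ α : ℝ} (hσ : 0 < σ) (hσv : σ ^ 2 = v) (hα : 0 ≤ α) (hα1 : α ≤ 1) :
    expAbsMass v (α / σ) ≤ 1 + α / σ * (∫ y, |y| ∂gaussianReal 0 v) + 4 * α ^ 2 := by
  have hi := (integrable_id_gaussianReal' 0 v).abs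
  have hie := integrable_exp_mul_abs_gaussianReal 0 v (b := 1 / σ) (by positivity)
  have h1 : Integrable (fun y => 1 + α / σ * |y|) (gaussianReal 0 v) :=
    (integrable_const _).add (hi.const_mul _)
  calc expAbsMass v (α / σ)
      ≤ ∫ y, ((1 + α / σ * |y|) + α ^ 2 * Real.exp (1 / σ * |y|)) ∂gaussianReal 0 v := by
        refine integral_mono (integrable_exp_mul_abs_gaussianReal 0 v (by positivity))
          (h1.add (hie.const_mul _)) fun y => ?_
        have := exp_mul_le_quadratic hα hα1 (s := 1 / σ * |y|) (by positivity)
        rwa [← mul_assoc, mul_one_div] at this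
    _ = 1 + α / σ * (∫ y, |y| ∂gaussianReal 0 v)
          + α ^ 2 * ∫ y, Real.exp (1 / σ * |y|) ∂gaussianReal 0 v := by
        rw [integral_add h1 (hie.const_mul _),
          integral_add (integrable_const _) (hi.const_mul _), integral_const_mul,
          integral_const_mul]
        simp
    _ ≤ _ := by
        have h := integral_exp_mul_abs_gaussianReal_le v (b := 1 / σ) (by positivity)
        have he : (v : ℝ) * (1 / σ) ^ 2 / 2 = 1 / 2 := by
          rw [← hσv]; field_simp
        rw [he] at h
        have h4 := exp_half_le_two
        nlinarith [sq_nonneg α]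

lemma integral_abs_gaussianReal_zero_le_mul {σ : ℝ} (hσ : 0 < σ) (hσv : σ ^ 2 = v) :
    ∫ y, |y| ∂gaussianReal 0 v ≤ 3 * σ := by
  have hie := integrable_exp_mul_abs_gaussianReal 0 v (b := 1 / σ) (by positivity)
  have h : ∫ y, |y| ∂gaussianReal 0 v
      ≤ ∫ y, (σ * Real.exp (1 / σ * |y|) - σ) ∂gaussianReal 0 v := by
    refine integral_mono (integrable_id_gaussianReal' 0 v).abs
      ((hie.const_mul _).sub (integrable_const _)) fun y => ?_
    have := mul_le_mul_of_nonneg_left (Real.add_one_le_exp (1 / σ * |y|)) hσ.le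
    rw [mul_add, ← mul_assoc, mul_one_div_cancel hσ.ne', one_mul, mul_one] at this
    show |y| ≤ σ * Real.exp (1 / σ * |y|) - σ
    linarith
  rw [integral_sub (hie.const_mul _) (integrable_const _), integral_const_mul] at h
  simp only [integral_const, probReal_univ, smul_eq_mul, one_mul] at h
  have h' := integral_exp_mul_abs_gaussianReal_le v (b := 1 / σ) (by positivity)
  have he : (v : ℝ) * (1 / σ) ^ 2 / 2 = 1 / 2 := by
    rw [← hσv]; field_simp
  rw [he] at h'
  have h4 := exp_half_le_two
  nlinarith

/-- The factor `1/6` is chosen here: `3α + 4α² ≤ ε/2 + ε²/9 ≤ ε`. -/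
lemma expAbsMass_le_one_add {σ ε : ℝ} (hσ : 0 < σ) (hσv : σ ^ 2 = v) (hε : 0 ≤ ε) (hε1 : ε ≤ 1)
    {α : ℝ} (hα : 0 ≤ α) (hαε : α ≤ ε / 6) : expAbsMass v (α / σ) ≤ 1 + ε := by
  have h1 := expAbsMass_le hσ hσv hα (by linarith)
  have h2 := mul_le_mul_of_nonneg_left (integral_abs_gaussianReal_zero_le_mul hσ hσv)
    (div_nonneg hα hσ.le)
  rw [show α / σ * (3 * σ) = 3 * α by field_simp] at h2
  nlinarith

lemma integrable_logRatio (m : ℝ) : Integrable (logRatio v b m) (gaussianReal m v) := by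
  have hi := integrable_id_gaussianReal' m v
  exact ((integrable_const _).add (((hi.const_mul m).sub (integrable_const _)).div_const _)).sub
    (hi.abs.const_mul b)

lemma integral_logRatio (m : ℝ) : ∫ y, logRatio v b m y ∂gaussianReal m v
    = Real.log (expAbsMass v b) + m ^ 2 / 2 / v - b * ∫ y, |y| ∂gaussianReal m v := by
  have hi := integrable_id_gaussianReal' m v
  have h1 : Integrable (fun y => (m * y - m ^ 2 / 2) / v) (gaussianReal m v) :=
    ((hi.const_mul m).sub (integrable_const _)).div_const _
  have h2 : Integrable (fun y => Real.log (expAbsMass v b) + (m * y - m ^ 2 / 2) / v)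
      (gaussianReal m v) := (integrable_const _).add h1
  simp only [logRatio]
  rw [integral_sub h2 (hi.abs.const_mul b),
    integral_add (integrable_const _) h1, integral_const_mul, integral_div,
    integral_sub (hi.const_mul m) (integrable_const _), integral_const_mul, integral_id_gaussianReal]
  simp
  ring

/-- Relative entropy of `N(m, v)` with respect to the hiding law: the first-order terms cancel. -/
lemma integral_logRatio_le {σ α : ℝ} (hσ : 0 < σ) (hσv : σ ^ 2 = v) (hα : 0 ≤ α) (hα1 : α ≤ 1)
    {m : ℝ} (hm : σ * α ≤ |m|) :
    ∫ y, logRatio v (α / σ) m y ∂gaussianReal m v ≤ 5 * m ^ 2 / v := by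
  have hb : 0 ≤ α / σ := by positivity
  have h1 := expAbsMass_le hσ hσv hα hα1
  have h2 := mul_le_mul_of_nonneg_left (integral_abs_gaussianReal_zero_le m v) hb
  have h3 := Real.log_le_sub_one_of_pos (one_pos.trans_le (one_le_expAbsMass (v := v) hb))
  -- Absorbs the remainder `4α²` into `m²/v`, for a total of `(1/2 + 4) m²/v`.
  have h4 : α ^ 2 ≤ m ^ 2 / v := by
    rw [← hσv, le_div_iff₀ (by positivity), ← sq_abs m]
    nlinarith [mul_nonneg hσ.le hα]
  have h5 : 5 * m ^ 2 / v = 5 * (m ^ 2 / v) := by ring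
  have h6 : m ^ 2 / 2 / v = m ^ 2 / v / 2 := by ring
  rw [integral_logRatio, h5, h6]
  nlinarith [sq_nonneg α]

end hidingLaw

/-! ### Domination and contamination. -/

/-- A Markov kernel `K` that dominates `(1 - ε) N` is an `ε`-contamination of `N`. -/
lemma exists_contamination {X Y : Type*} [MeasurableSpace X] [MeasurableSpace Y] {N K : Kernel X Y}
    [IsMarkovKernel N] [IsMarkovKernel K] {h : X → Y → ℝ} (hm : Measurable (Function.uncurry h))
    (hN : ∀ x, N x = (K x).withDensity fun y => ENNReal.ofReal (h x y)) {ε : ℝ} (hε : 0 < ε)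
    (hε1 : ε ≤ 1) (h0 : ∀ x y, 0 ≤ h x y) (h1 : ∀ x y, (1 - ε) * h x y ≤ 1) :
    ∃ Q : Kernel X Y, IsMarkovKernel Q ∧
      ∀ x, ENNReal.ofReal (1 - ε) • N x + ENNReal.ofReal ε • Q x = K x := by
  -- The density relative to `K` of the remainder `(K - (1 - ε) N)/ε`.
  let q : X → Y → ENNReal := fun x y => ENNReal.ofReal ((1 - (1 - ε) * h x y) / ε)
  have hq : Measurable (Function.uncurry q) := by
    have : Function.uncurry q
        = fun z => ENNReal.ofReal ((1 - (1 - ε) * Function.uncurry h z) / ε) := rfl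
    rw [this]
    fun_prop
  have hx (x : X) : ENNReal.ofReal (1 - ε) • N x + ENNReal.ofReal ε • K.withDensity q x = K x := by
    have hmx : Measurable (h x) := hm.comp measurable_prodMk_left
    have hqx : Measurable (q x) := hq.comp measurable_prodMk_left
    rw [Kernel.withDensity_apply _ hq, hN, ← withDensity_smul _ hmx.ennreal_ofReal,
      ← withDensity_smul _ hqx, ← withDensity_add_left (hmx.ennreal_ofReal.const_smul _)]
    convert withDensity_one
    funext y
    simp only [Pi.add_apply, Pi.smul_apply, smul_eq_mul, q, Pi.one_apply]
    rw [← ENNReal.ofReal_mul (by linarith), ← ENNReal.ofReal_mul hε.le, ← ENNReal.ofReal_add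
      (mul_nonneg (by linarith) (h0 x y)) (by
        rw [mul_div_cancel₀ _ hε.ne']; linarith [h1 x y]), mul_div_cancel₀ _ hε.ne']
    simp
  refine ⟨K.withDensity q, ⟨fun x => ⟨?_⟩⟩, hx⟩
  -- Comparing total masses in the mixture identity forces `Q x` to have mass one.
  have hu := congrArg (fun μ : Measure Y => μ Set.univ) (hx x)
  simp only [Measure.add_apply, Measure.smul_apply, measure_univ, smul_eq_mul, mul_one] at hu
  have he : ENNReal.ofReal (1 - ε) + ENNReal.ofReal ε = 1 := by
    rw [← ENNReal.ofReal_add (by linarith) hε.le]; simp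
  rw [← he, ENNReal.add_right_inj ENNReal.ofReal_ne_top] at hu
  exact (ENNReal.mul_eq_left (by simpa using hε) ENNReal.ofReal_ne_top).1 hu

/-! ### Linear forms of a standard Gaussian vector. -/

section stdGaussian

variable {p : ℕ}

lemma map_inner_stdGaussian (β : EuclideanSpace ℝ (Fin p)) :
    (stdGaussian (EuclideanSpace ℝ (Fin p))).map (fun x => inner ℝ x β)
      = gaussianReal 0 (‖β‖ ^ 2).toNNReal := by
  have h := IsGaussian.map_eq_gaussianReal (μ := stdGaussian (EuclideanSpace ℝ (Fin p)))
    (innerSL ℝ β)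
  rw [integral_strongDual_stdGaussian, variance_dual_stdGaussian, innerSL_apply_norm] at h
  rw [← h]
  congr 1
  funext x
  simp [real_inner_comm]

lemma integrable_inner_sq_stdGaussian (β : EuclideanSpace ℝ (Fin p)) :
    Integrable (fun x => (inner ℝ x β) ^ 2) (stdGaussian (EuclideanSpace ℝ (Fin p))) := by
  have h : Integrable (fun y : ℝ => y ^ 2) ((stdGaussian (EuclideanSpace ℝ (Fin p))).map
      (fun x => inner ℝ x β)) := by
    rw [map_inner_stdGaussian]
    exact (memLp_id_gaussianReal 2).integrable_sq
  exact h.comp_measurable (by fun_prop)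

lemma integral_inner_sq_stdGaussian (β : EuclideanSpace ℝ (Fin p)) :
    ∫ x, (inner ℝ x β) ^ 2 ∂stdGaussian (EuclideanSpace ℝ (Fin p)) = ‖β‖ ^ 2 := by
  have h := integral_map (μ := stdGaussian (EuclideanSpace ℝ (Fin p)))
    (φ := fun x => inner ℝ x β) (by fun_prop)
    (f := fun y : ℝ => y ^ 2) (by fun_prop)
  rw [map_inner_stdGaussian] at h
  rw [← h]
  have hv := variance_fun_id_gaussianReal (μ := 0) (v := (‖β‖ ^ 2).toNNReal)
  rw [variance_of_integral_eq_zero (by fun_prop) integral_id_gaussianReal] at hv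
  rw [hv, Real.coe_toNNReal _ (sq_nonneg _)]

lemma integral_exp_mul_abs_inner_stdGaussian_le (β : EuclideanSpace ℝ (Fin p)) {b : ℝ}
    (hb : 0 ≤ b) : Integrable (fun x => Real.exp (b * |inner ℝ x β|))
        (stdGaussian (EuclideanSpace ℝ (Fin p))) ∧
      ∫ x, Real.exp (b * |inner ℝ x β|) ∂stdGaussian (EuclideanSpace ℝ (Fin p))
        ≤ 2 * Real.exp (‖β‖ ^ 2 * b ^ 2 / 2) := by
  have hi := integrable_exp_mul_abs_gaussianReal 0 (‖β‖ ^ 2).toNNReal hb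
  have h := integral_exp_mul_abs_gaussianReal_le (‖β‖ ^ 2).toNNReal hb
  rw [← map_inner_stdGaussian] at hi h
  rw [integral_map (by fun_prop) (by fun_prop), Real.coe_toNNReal _ (sq_nonneg _)] at h
  exact ⟨hi.comp_measurable (by fun_prop), h⟩

/-- Gaussian tail bound for the truncated second moment of a linear form. -/
lemma integral_indicator_inner_sq_stdGaussian_le {β : EuclideanSpace ℝ (Fin p)} {R t : ℝ}
    (hR : 0 < R) (hβ : ‖β‖ ≤ R) (ht : 0 ≤ t) :
    ∫ x, {x : EuclideanSpace ℝ (Fin p) | R * t ≤ |inner ℝ x β|}.indicator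
        (fun x => (inner ℝ x β) ^ 2) x ∂stdGaussian (EuclideanSpace ℝ (Fin p))
      ≤ R ^ 2 * (4 * Real.exp (3 / 2 - t ^ 2 / 4)) := by
  have hms : MeasurableSet {x : EuclideanSpace ℝ (Fin p) | R * t ≤ |inner ℝ x β|} :=
    measurableSet_le measurable_const (by fun_prop)
  -- With `z = |xᵀβ|/R ≥ t`, one has `z² ≤ 2e^z ≤ 2e^{z + t(z - t)}`, which calls for the
  -- exponential moment at `(1 + t)/R`.
  obtain ⟨hi, hle⟩ := integral_exp_mul_abs_inner_stdGaussian_le β (b := (1 + t) / R)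
    (by positivity)
  calc _ ≤ ∫ x, R ^ 2 * (2 * Real.exp (-t ^ 2)) * Real.exp ((1 + t) / R * |inner ℝ x β|)
          ∂stdGaussian (EuclideanSpace ℝ (Fin p)) := by
        refine integral_mono ((integrable_inner_sq_stdGaussian β).indicator hms)
          (hi.const_mul _) fun x => ?_
        refine Set.indicator_apply_le' (fun hx => ?_) fun _ => by positivity
        have hz : t ≤ |inner ℝ x β| / R := by rw [le_div_iff₀ hR, mul_comm]; exact hx
        set z := |inner ℝ x β| / R with hzd
        have hxz : (inner ℝ x β) ^ 2 = R ^ 2 * z ^ 2 := by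
          rw [← sq_abs, hzd, div_pow, mul_div_cancel₀ _ (by positivity)]
        have he : (1 + t) / R * |inner ℝ x β| = z + t * z := by rw [hzd]; ring
        rw [he]
        show (inner ℝ x β) ^ 2 ≤ _
        rw [hxz, mul_assoc, mul_assoc, ← Real.exp_add]
        gcongr
        have h1 := Real.quadratic_le_exp_of_nonneg (ht.trans hz)
        have h2 : Real.exp z ≤ Real.exp (-t ^ 2 + (z + t * z)) :=
          Real.exp_le_exp.2 (by nlinarith)
        nlinarith [ht.trans hz]
    _ ≤ R ^ 2 * (2 * Real.exp (-t ^ 2)) * (2 * Real.exp ((1 + t) ^ 2 / 2)) := by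
        rw [integral_const_mul]
        refine mul_le_mul_of_nonneg_left (hle.trans ?_) (by positivity)
        have : ‖β‖ ^ 2 * ((1 + t) / R) ^ 2 ≤ (1 + t) ^ 2 := by
          rw [div_pow, ← mul_div_assoc, div_le_iff₀ (by positivity), mul_comm]
          gcongr
        gcongr
    _ = R ^ 2 * (4 * Real.exp (-t ^ 2 + (1 + t) ^ 2 / 2)) := by
        rw [Real.exp_add]; ring
    _ ≤ _ := by
        gcongr
        nlinarith [sq_nonneg (t - 2)]

end stdGaussian

/-! ### Contaminated response kernels and their likelihood ratios. -/

variable {p : ℕ}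

lemma responseKernel_apply (ε σ : ℝ) (β : EuclideanSpace ℝ (Fin p))
    (Q : Kernel (EuclideanSpace ℝ (Fin p)) ℝ) (x : EuclideanSpace ℝ (Fin p)) :
    responseKernel ε σ β Q x = ENNReal.ofReal (1 - ε) •
      gaussianReal (inner ℝ x β) (σ ^ 2).toNNReal + ENNReal.ofReal ε • Q x := rfl

lemma isMarkovKernel_responseKernel {ε : ℝ} (hε : 0 ≤ ε) (hε1 : ε ≤ 1) (σ : ℝ)
    (β : EuclideanSpace ℝ (Fin p)) (Q : Kernel (EuclideanSpace ℝ (Fin p)) ℝ) [IsMarkovKernel Q] :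
    IsMarkovKernel (responseKernel ε σ β Q) := by
  refine ⟨fun x => ⟨?_⟩⟩
  rw [responseKernel_apply]
  simp only [Measure.add_apply, Measure.smul_apply, measure_univ, smul_eq_mul, mul_one]
  rw [← ENNReal.ofReal_add (by linarith) hε]
  simp

lemma isProbabilityMeasure_observationLaw {ε : ℝ} (hε : 0 ≤ ε) (hε1 : ε ≤ 1) (σ : ℝ)
    (β : EuclideanSpace ℝ (Fin p)) (Q : Kernel (EuclideanSpace ℝ (Fin p)) ℝ) [IsMarkovKernel Q] :
    IsProbabilityMeasure (observationLaw ε σ β Q) := by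
  have := isMarkovKernel_responseKernel hε hε1 σ β Q
  unfold observationLaw
  infer_instance

/-- The uncontaminated response kernel `x ↦ N(xᵀβ, σ²)`. -/
noncomputable def gaussianResponse (σ : ℝ) (β : EuclideanSpace ℝ (Fin p)) :
    Kernel (EuclideanSpace ℝ (Fin p)) ℝ := responseKernel 0 σ β 0

lemma gaussianResponse_apply (σ : ℝ) (β x : EuclideanSpace ℝ (Fin p)) :
    gaussianResponse σ β x = gaussianReal (inner ℝ x β) (σ ^ 2).toNNReal := by
  simp [gaussianResponse, responseKernel_apply]

instance isMarkovKernel_gaussianResponse (σ : ℝ) (β : EuclideanSpace ℝ (Fin p)) :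
    IsMarkovKernel (gaussianResponse σ β) :=
  ⟨fun x => by rw [gaussianResponse_apply]; infer_instance⟩

lemma measurableSet_abs_inner_lt (a : ℝ) (β : EuclideanSpace ℝ (Fin p)) :
    MeasurableSet {x : EuclideanSpace ℝ (Fin p) | |inner ℝ x β| < a} :=
  measurableSet_lt (by fun_prop) measurable_const

/-- The contaminated responses: the hiding law where the regression mean is below `a` in absolute
value, and the uncontaminated law elsewhere. -/
noncomputable def hiddenResponse (σ b a : ℝ) (β : EuclideanSpace ℝ (Fin p)) :
    Kernel (EuclideanSpace ℝ (Fin p)) ℝ :=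
  open scoped Classical in
  Kernel.piecewise (measurableSet_abs_inner_lt a β)
    (Kernel.const _ (hidingLaw (σ ^ 2).toNNReal b)) (gaussianResponse σ β)

/-- The log-likelihood ratio of `hiddenResponse` with respect to the hiding law. -/
noncomputable def hiddenLogRatio (σ b a : ℝ) (β : EuclideanSpace ℝ (Fin p))
    (z : EuclideanSpace ℝ (Fin p) × ℝ) : ℝ :=
  if |inner ℝ z.1 β| < a then 0 else logRatio (σ ^ 2).toNNReal b (inner ℝ z.1 β) z.2

section hiddenResponse

variable {σ b a : ℝ} {β : EuclideanSpace ℝ (Fin p)}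

lemma hiddenResponse_of_lt {x : EuclideanSpace ℝ (Fin p)} (hx : |inner ℝ x β| < a) :
    hiddenResponse σ b a β x = hidingLaw (σ ^ 2).toNNReal b :=
  if_pos hx

lemma hiddenResponse_of_not_lt {x : EuclideanSpace ℝ (Fin p)} (hx : ¬|inner ℝ x β| < a) :
    hiddenResponse σ b a β x = gaussianReal (inner ℝ x β) (σ ^ 2).toNNReal :=
  (if_neg hx).trans (gaussianResponse_apply σ β x)

lemma isMarkovKernel_hiddenResponse (hb : 0 ≤ b) : IsMarkovKernel (hiddenResponse σ b a β) := by
  have := isProbabilityMeasure_hidingLaw (v := (σ ^ 2).toNNReal) hb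
  unfold hiddenResponse
  infer_instance

lemma measurable_inner_fst_logRatio : Measurable fun z : EuclideanSpace ℝ (Fin p) × ℝ =>
    logRatio (σ ^ 2).toNNReal b (inner ℝ z.1 β) z.2 :=
  measurable_logRatio (f := fun z : EuclideanSpace ℝ (Fin p) × ℝ => inner ℝ z.1 β)
    (by fun_prop) measurable_snd

lemma measurableSet_abs_inner_fst_lt (a : ℝ) (β : EuclideanSpace ℝ (Fin p)) :
    MeasurableSet {z : EuclideanSpace ℝ (Fin p) × ℝ | |inner ℝ z.1 β| < a} :=
  measurableSet_lt (by fun_prop) measurable_const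

lemma measurable_hiddenLogRatio : Measurable (hiddenLogRatio σ b a β) :=
  Measurable.ite (measurableSet_abs_inner_fst_lt a β) measurable_const
    measurable_inner_fst_logRatio

lemma hiddenResponse_withDensity (hσ : 0 < σ) (hb : 0 ≤ b) (x : EuclideanSpace ℝ (Fin p)) :
    (hiddenResponse σ b a β x).withDensity
        (fun y => ENNReal.ofReal (Real.exp (-hiddenLogRatio σ b a β (x, y))))
      = hidingLaw (σ ^ 2).toNNReal b := by
  by_cases hx : |inner ℝ x β| < a
  · simp only [hiddenResponse_of_lt hx, hiddenLogRatio, if_pos hx, neg_zero, Real.exp_zero,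
      ENNReal.ofReal_one]
    exact withDensity_one
  · simp only [hiddenResponse_of_not_lt hx, hiddenLogRatio, if_neg hx]
    exact gaussianReal_withDensity_neg_logRatio (by simpa using hσ.ne') hb _

/-- The right-hand side is free of `β`: it is the common reference law for all parameters. -/
lemma compProd_hiddenResponse_withDensity (hσ : 0 < σ) (hb : 0 ≤ b) :
    (stdGaussian (EuclideanSpace ℝ (Fin p)) ⊗ₘ hiddenResponse σ b a β).withDensity
        (fun z => ENNReal.ofReal (Real.exp (-hiddenLogRatio σ b a β z)))
      = (stdGaussian (EuclideanSpace ℝ (Fin p))).prod (hidingLaw (σ ^ 2).toNNReal b) := by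
  have hM := isMarkovKernel_hiddenResponse (σ := σ) (a := a) (β := β) hb
  have hG := isProbabilityMeasure_hidingLaw (v := (σ ^ 2).toNNReal) hb
  let f : EuclideanSpace ℝ (Fin p) → ℝ → ENNReal :=
    fun x y => ENNReal.ofReal (Real.exp (-hiddenLogRatio σ b a β (x, y)))
  have hf : Measurable (Function.uncurry f) := measurable_hiddenLogRatio.neg.exp.ennreal_ofReal
  have hK : (hiddenResponse σ b a β).withDensity f
      = Kernel.const _ (hidingLaw (σ ^ 2).toNNReal b) := by
    ext1 x
    rw [Kernel.withDensity_apply _ hf]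
    exact hiddenResponse_withDensity hσ hb x
  have : IsSFiniteKernel ((hiddenResponse σ b a β).withDensity f) := by
    rw [hK]; infer_instance
  rw [← Measure.compProd_const, ← hK, Measure.compProd_withDensity hf]

lemma integrable_hiddenLogRatio_apply (x : EuclideanSpace ℝ (Fin p)) :
    Integrable (fun y => hiddenLogRatio σ b a β (x, y)) (hiddenResponse σ b a β x) := by
  by_cases hx : |inner ℝ x β| < a
  · simp [hiddenLogRatio, if_pos hx]
  · simp only [hiddenResponse_of_not_lt hx, hiddenLogRatio, if_neg hx]
    exact integrable_logRatio _

lemma integral_hiddenLogRatio_apply_le {α : ℝ} (hσ : 0 < σ) (hα : 0 ≤ α) (hα1 : α ≤ 1)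
    (x : EuclideanSpace ℝ (Fin p)) :
    ∫ y, hiddenLogRatio σ (α / σ) (σ * α) β (x, y) ∂hiddenResponse σ (α / σ) (σ * α) β x
      ≤ 5 / σ ^ 2 * {x : EuclideanSpace ℝ (Fin p) | σ * α ≤ |inner ℝ x β|}.indicator
          (fun x => (inner ℝ x β) ^ 2) x := by
  by_cases hx : |inner ℝ x β| < σ * α
  · rw [Set.indicator_of_notMem (by simpa using hx)]
    simp [hiddenLogRatio, if_pos hx]
  · rw [Set.indicator_of_mem (by simpa using hx)]
    simp only [hiddenResponse_of_not_lt hx, hiddenLogRatio, if_neg hx]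
    have hv : σ ^ 2 = ((σ ^ 2).toNNReal : ℝ) := (Real.coe_toNNReal _ (sq_nonneg σ)).symm
    have h := integral_logRatio_le hσ hv hα hα1 (not_lt.1 hx)
    rw [← hv] at h
    exact h.trans_eq (by ring)

/-- Serves joint integrability. The bound on the signed mean suffices, since `|L| ≤ L + 2e^{-L}` and
`e^{-L}` integrates to one. -/
lemma integral_norm_hiddenLogRatio_apply_le {α : ℝ} (hσ : 0 < σ) (hα : 0 ≤ α) (hα1 : α ≤ 1)
    (x : EuclideanSpace ℝ (Fin p)) :
    ∫ y, ‖hiddenLogRatio σ (α / σ) (σ * α) β (x, y)‖ ∂hiddenResponse σ (α / σ) (σ * α) β x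
      ≤ 5 / σ ^ 2 * (inner ℝ x β) ^ 2 + 2 := by
  set K := hiddenResponse σ (α / σ) (σ * α) β x
  set L := fun y => hiddenLogRatio σ (α / σ) (σ * α) β (x, y) with hLdef
  have hb : 0 ≤ α / σ := by positivity
  have hLm : Measurable L := measurable_hiddenLogRatio.comp measurable_prodMk_left
  have hL : Integrable L K := integrable_hiddenLogRatio_apply x
  have hmass : ∫⁻ y, ENNReal.ofReal (Real.exp (-L y)) ∂K = 1 := by
    have := isProbabilityMeasure_hidingLaw (v := (σ ^ 2).toNNReal) hb
    have h := congrArg (fun μ : Measure ℝ => μ Set.univ)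
      (hiddenResponse_withDensity (a := σ * α) (β := β) hσ hb x)
    simpa [withDensity_apply] using h
  have he : Integrable (fun y => Real.exp (-L y)) K :=
    ⟨by fun_prop, by
      rw [hasFiniteIntegral_iff_ofReal (.of_forall fun y => (Real.exp_pos _).le), hmass]
      exact ENNReal.one_lt_top⟩
  have he1 : ∫ y, Real.exp (-L y) ∂K = 1 := by
    rw [integral_eq_lintegral_of_nonneg_ae (.of_forall fun y => (Real.exp_pos _).le)
      (by fun_prop), hmass, ENNReal.toReal_one]
  calc ∫ y, ‖L y‖ ∂K ≤ ∫ y, (L y + 2 * Real.exp (-L y)) ∂K := by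
        refine integral_mono hL.norm (hL.add (he.const_mul 2)) fun y => ?_
        have := Real.add_one_le_exp (-L y)
        have h0 := Real.exp_pos (-L y)
        show ‖L y‖ ≤ L y + 2 * Real.exp (-L y)
        rw [Real.norm_eq_abs, abs_le]
        constructor <;> linarith
    _ = ∫ y, L y ∂K + 2 := by
        rw [integral_add hL (he.const_mul 2), integral_const_mul, he1, mul_one]
    _ ≤ _ := by
        gcongr
        refine (integral_hiddenLogRatio_apply_le hσ hα hα1 x).trans ?_
        gcongr
        exact Set.indicator_le_self' (fun _ _ => sq_nonneg _) x

lemma integrable_hiddenLogRatio {α : ℝ} (hσ : 0 < σ) (hα : 0 ≤ α) (hα1 : α ≤ 1) :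
    Integrable (hiddenLogRatio σ (α / σ) (σ * α) β)
      (stdGaussian (EuclideanSpace ℝ (Fin p)) ⊗ₘ hiddenResponse σ (α / σ) (σ * α) β) := by
  have := isMarkovKernel_hiddenResponse (σ := σ) (a := σ * α) (β := β) (div_nonneg hα hσ.le)
  rw [Measure.integrable_compProd_iff measurable_hiddenLogRatio.aestronglyMeasurable]
  refine ⟨.of_forall integrable_hiddenLogRatio_apply, ?_⟩
  refine (((integrable_inner_sq_stdGaussian β).const_mul (5 / σ ^ 2)).add
    (integrable_const 2)).mono' ?_ (.of_forall fun x => ?_)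
  · exact (measurable_hiddenLogRatio.stronglyMeasurable.norm.integral_kernel_prod_right'
      (κ := hiddenResponse σ (α / σ) (σ * α) β)).aestronglyMeasurable
  · rw [Real.norm_of_nonneg (integral_nonneg fun y => norm_nonneg _)]
    exact integral_norm_hiddenLogRatio_apply_le hσ hα hα1 x

lemma integral_hiddenLogRatio_le {α : ℝ} (hσ : 0 < σ) (hα : 0 ≤ α) (hα1 : α ≤ 1) :
    ∫ z, hiddenLogRatio σ (α / σ) (σ * α) β z
        ∂(stdGaussian (EuclideanSpace ℝ (Fin p)) ⊗ₘ hiddenResponse σ (α / σ) (σ * α) β)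
      ≤ 5 / σ ^ 2 * ∫ x, {x : EuclideanSpace ℝ (Fin p) | σ * α ≤ |inner ℝ x β|}.indicator
          (fun x => (inner ℝ x β) ^ 2) x ∂stdGaussian (EuclideanSpace ℝ (Fin p)) := by
  have := isMarkovKernel_hiddenResponse (σ := σ) (a := σ * α) (β := β) (div_nonneg hα hσ.le)
  have hL := integrable_hiddenLogRatio (β := β) hσ hα hα1
  rw [Measure.integral_compProd hL, ← integral_const_mul]
  have hinner : Integrable (fun x => ∫ y, hiddenLogRatio σ (α / σ) (σ * α) β (x, y)
      ∂hiddenResponse σ (α / σ) (σ * α) β x) (stdGaussian (EuclideanSpace ℝ (Fin p))) :=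
    ((Measure.integrable_compProd_iff hL.aestronglyMeasurable).1 hL).2.mono'
      (measurable_hiddenLogRatio.stronglyMeasurable.integral_kernel_prod_right'
        (κ := hiddenResponse σ (α / σ) (σ * α) β)).aestronglyMeasurable
      (.of_forall fun x => norm_integral_le_integral_norm _)
  refine integral_mono hinner (((integrable_inner_sq_stdGaussian β).indicator
    (measurableSet_le measurable_const (by fun_prop))).const_mul _)
    (integral_hiddenLogRatio_apply_le hσ hα hα1)

/-- The hidden responses arise from an `ε`-contamination. -/
lemma exists_responseKernel_eq_hiddenResponse {ε α : ℝ} (hσ : 0 < σ) (hε : 0 ≤ ε) (hε1 : ε ≤ 1)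
    (hα : 0 ≤ α) (hαε : α ≤ ε / 6) (β : EuclideanSpace ℝ (Fin p)) :
    ∃ Q : Kernel (EuclideanSpace ℝ (Fin p)) ℝ, IsMarkovKernel Q ∧
      responseKernel ε σ β Q = hiddenResponse σ (α / σ) (σ * α) β := by
  set v := (σ ^ 2).toNNReal with hvdef
  have hv : σ ^ 2 = (v : ℝ) := (Real.coe_toNNReal _ (sq_nonneg σ)).symm
  have hv0 : v ≠ 0 := by simpa [hvdef] using hσ.ne'
  have hb : 0 ≤ α / σ := by positivity
  rcases hε.eq_or_lt with rfl | hε0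
  -- Without contamination `α = 0`, and no covariate satisfies `|xᵀβ| < 0`: nothing is hidden.
  · obtain rfl : α = 0 := le_antisymm (by linarith) hα
    refine ⟨gaussianResponse σ β, inferInstance, ?_⟩
    ext1 x
    rw [responseKernel_apply, hiddenResponse_of_not_lt (by simp)]
    simp
  have hM := isMarkovKernel_hiddenResponse (σ := σ) (a := σ * α) (β := β) hb
  let h : EuclideanSpace ℝ (Fin p) → ℝ → ℝ := fun x y =>
    if |inner ℝ x β| < σ * α then Real.exp (logRatio v (α / σ) (inner ℝ x β) y) else 1
  have hm : Measurable (Function.uncurry h) :=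
    Measurable.ite (measurableSet_abs_inner_fst_lt (σ * α) β)
      measurable_inner_fst_logRatio.exp measurable_const
  have hN (x) : gaussianResponse σ β x = (hiddenResponse σ (α / σ) (σ * α) β x).withDensity
      fun y => ENNReal.ofReal (h x y) := by
    rw [gaussianResponse_apply]
    by_cases hx : |inner ℝ x β| < σ * α
    · simp only [hiddenResponse_of_lt hx, h, if_pos hx]
      exact (hidingLaw_withDensity hv0 hb _).symm
    · simp only [hiddenResponse_of_not_lt hx, h, if_neg hx, ENNReal.ofReal_one]
      exact withDensity_one.symm
  obtain ⟨Q, hQ, hQe⟩ := exists_contamination hm hN hε0 hε1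
    (fun x y => by
      simp only [h]
      split_ifs
      exacts [(Real.exp_pos _).le, zero_le_one])
    (fun x y => by
      simp only [h]
      split_ifs with hx
      -- For `|m| < σα` the penalty `b|y|` beats the linear term `my/v`, so the density is at most
      -- `M ≤ 1 + ε`; then `(1 - ε)(1 + ε) ≤ 1`.
      · have hle : Real.exp (logRatio v (α / σ) (inner ℝ x β) y) ≤ 1 + ε := by
          refine le_trans ?_ (expAbsMass_le_one_add hσ hv hε hε1 hα hαε)
          rw [← Real.le_log_iff_exp_le (one_pos.trans_le (one_le_expAbsMass hb)), logRatio]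
          have h1 : (inner ℝ x β * y - (inner ℝ x β) ^ 2 / 2) / v ≤ α / σ * |y| := by
            rw [← hv, div_le_iff₀ (by positivity)]
            calc inner ℝ x β * y - (inner ℝ x β) ^ 2 / 2 ≤ |inner ℝ x β * y| := by
                  nlinarith [le_abs_self (inner ℝ x β * y), sq_nonneg (inner ℝ x β : ℝ)]
              _ ≤ σ * α * |y| := by rw [abs_mul]; gcongr
              _ = α / σ * |y| * σ ^ 2 := by field_simp
          linarith
        nlinarith
      · linarith)
  refine ⟨Q, hQ, ?_⟩
  ext1 x
  rw [responseKernel_apply, ← gaussianResponse_apply, hQe]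

end hiddenResponse

/-! ### Assembly of the lower bounds. -/

/-- If every coefficient vector in a ball of radius `R` can be contaminated so that `n` observations
carry relative entropy at most `5 p` with respect to a common law, then no estimator has error
below `e⁻¹² R` with probability more than one half. -/
lemma exists_dataLaw_error_ge {n : ℕ} (hp : 1 ≤ p) {ε σ R : ℝ} (hε : 0 ≤ ε) (hε1 : ε ≤ 1)
    (hR : 0 < R) (ν : Measure (EuclideanSpace ℝ (Fin p) × ℝ)) [IsProbabilityMeasure ν]
    (h : ∀ β : EuclideanSpace ℝ (Fin p), ‖β‖ ≤ R →
      ∃ Q : Kernel (EuclideanSpace ℝ (Fin p)) ℝ, IsMarkovKernel Q ∧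
        ∃ L : EuclideanSpace ℝ (Fin p) × ℝ → ℝ, Measurable L ∧
          Integrable L (observationLaw ε σ β Q) ∧
          (observationLaw ε σ β Q).withDensity (fun z => ENNReal.ofReal (Real.exp (-L z))) = ν ∧
          n * ∫ z, L z ∂observationLaw ε σ β Q ≤ 5 * p)
    {βhat : (Fin n → EuclideanSpace ℝ (Fin p) × ℝ) → EuclideanSpace ℝ (Fin p)}
    (hβhat : Measurable βhat) :
    ∃ (β : EuclideanSpace ℝ (Fin p)) (Q : Kernel (EuclideanSpace ℝ (Fin p)) ℝ),
      IsMarkovKernel Q ∧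
        1 / 2 ≤ dataLaw n ε σ β Q {D | Real.exp (-12) * R ≤ ‖βhat D - β‖} := by
  obtain ⟨β, hβ, hsmall⟩ := exists_norm_le_measure_near_le (Measure.pi fun _ : Fin n => ν) hβhat
    (r := Real.exp (-12) * R) (by positivity) hR
  obtain ⟨Q, hQ, L, hLm, hLi, hLν, hL⟩ := h β hβ
  have hP := isProbabilityMeasure_observationLaw hε hε1 σ β Q
  refine ⟨β, Q, hQ, ?_⟩
  have hA : MeasurableSet {D | ‖βhat D - β‖ < Real.exp (-12) * R} :=
    measurableSet_lt (by fun_prop) measurable_const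
  -- The choice `t = 12p` makes `e^t` cancel the volume ratio `e^{-12p}`, leaving `12p · P(A) ≤ 5p +
  -- 1 ≤ 6p`.
  have key := mul_measureReal_pi_le_of_withDensity hLm hLi hLν n hA (12 * p)
  rw [finrank_euclideanSpace_fin, mul_div_cancel_right₀ _ hR.ne', ← Real.exp_nat_mul] at hsmall
  have hp' : (1 : ℝ) ≤ p := by exact_mod_cast hp
  have h1 := mul_le_mul_of_nonneg_left hsmall (Real.exp_pos (12 * p)).le
  rw [← Real.exp_add, show (12 * p + p * -12 : ℝ) = 0 by ring, Real.exp_zero] at h1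
  have hhalf : (dataLaw n ε σ β Q).real {D | ‖βhat D - β‖ < Real.exp (-12) * R} ≤ 1 / 2 := by
    unfold dataLaw
    nlinarith
  have : IsProbabilityMeasure (dataLaw n ε σ β Q) := by unfold dataLaw; infer_instance
  have hc : {D | Real.exp (-12) * R ≤ ‖βhat D - β‖}
      = {D | ‖βhat D - β‖ < Real.exp (-12) * R}ᶜ := by
    ext D; simp
  have hge : 1 / 2 ≤ (dataLaw n ε σ β Q).real {D | Real.exp (-12) * R ≤ ‖βhat D - β‖} := by
    rw [hc, probReal_compl_eq_one_sub hA]; linarith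
  rw [show (1 / 2 : ENNReal) = ENNReal.ofReal (1 / 2) by simp]
  exact (ENNReal.ofReal_le_iff_le_toReal (measure_ne_top _ _)).2 hge

/-- Lower bound from hiding the responses with `|xᵀβ| < σ α`, given control of the second moment of
the remaining linear form. -/
lemma exists_dataLaw_error_ge_of_truncated {n : ℕ} (hp : 1 ≤ p) {ε σ R α : ℝ} (hε : 0 ≤ ε)
    (hε1 : ε ≤ 1) (hσ : 0 < σ) (hR : 0 < R) (hα : 0 ≤ α) (hαε : α ≤ ε / 6)
    (h : ∀ β : EuclideanSpace ℝ (Fin p), ‖β‖ ≤ R →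
      n * ∫ x, {x : EuclideanSpace ℝ (Fin p) | σ * α ≤ |inner ℝ x β|}.indicator
          (fun x => (inner ℝ x β) ^ 2) x ∂stdGaussian (EuclideanSpace ℝ (Fin p)) ≤ p * σ ^ 2)
    {βhat : (Fin n → EuclideanSpace ℝ (Fin p) × ℝ) → EuclideanSpace ℝ (Fin p)}
    (hβhat : Measurable βhat) :
    ∃ (β : EuclideanSpace ℝ (Fin p)) (Q : Kernel (EuclideanSpace ℝ (Fin p)) ℝ),
      IsMarkovKernel Q ∧
        1 / 2 ≤ dataLaw n ε σ β Q {D | Real.exp (-12) * R ≤ ‖βhat D - β‖} := by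
  have hα1 : α ≤ 1 := by linarith
  have hb : 0 ≤ α / σ := by positivity
  have hG := isProbabilityMeasure_hidingLaw (v := (σ ^ 2).toNNReal) hb
  refine exists_dataLaw_error_ge hp hε hε1 hR ((stdGaussian (EuclideanSpace ℝ (Fin p))).prod
    (hidingLaw (σ ^ 2).toNNReal (α / σ))) (fun β hβ => ?_) hβhat
  obtain ⟨Q, hQ, hQe⟩ := exists_responseKernel_eq_hiddenResponse hσ hε hε1 hα hαε β
  refine ⟨Q, hQ, hiddenLogRatio σ (α / σ) (σ * α) β, measurable_hiddenLogRatio, ?_⟩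
  rw [observationLaw, hQe]
  refine ⟨integrable_hiddenLogRatio hσ hα hα1, compProd_hiddenResponse_withDensity hσ hb, ?_⟩
  calc _ ≤ n * (5 / σ ^ 2 *
        ∫ x, {x : EuclideanSpace ℝ (Fin p) | σ * α ≤ |inner ℝ x β|}.indicator
          (fun x => (inner ℝ x β) ^ 2) x ∂stdGaussian (EuclideanSpace ℝ (Fin p))) :=
        mul_le_mul_of_nonneg_left (integral_hiddenLogRatio_le hσ hα hα1) n.cast_nonneg
    _ ≤ 5 / σ ^ 2 * (p * σ ^ 2) := by
        rw [mul_left_comm]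
        exact mul_le_mul_of_nonneg_left (h β hβ) (by positivity)
    _ = 5 * p := by field_simp

/-- The parametric part of the lower bound. -/
lemma exists_dataLaw_error_ge_parametric {n : ℕ} (hn : 1 ≤ n) (hp : 1 ≤ p) {ε σ : ℝ} (hε : 0 ≤ ε)
    (hε1 : ε ≤ 1) (hσ : 0 < σ)
    {βhat : (Fin n → EuclideanSpace ℝ (Fin p) × ℝ) → EuclideanSpace ℝ (Fin p)}
    (hβhat : Measurable βhat) :
    ∃ (β : EuclideanSpace ℝ (Fin p)) (Q : Kernel (EuclideanSpace ℝ (Fin p)) ℝ),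
      IsMarkovKernel Q ∧ 1 / 2 ≤ dataLaw n ε σ β Q
        {D | Real.exp (-12) * (σ * √((p : ℝ) / n)) ≤ ‖βhat D - β‖} := by
  have hn' : (0 : ℝ) < n := by exact_mod_cast hn
  have hp' : (0 : ℝ) < p := by exact_mod_cast hp
  -- Take `α = 0`: the hiding law is `N(0, σ²)` and the truncation is void, so the full second
  -- moment `‖β‖²` appears.
  refine exists_dataLaw_error_ge_of_truncated hp hε hε1 hσ (by positivity) le_rfl (by linarith)
    (fun β hβ => ?_) hβhat
  have hs : {x : EuclideanSpace ℝ (Fin p) | σ * 0 ≤ |inner ℝ x β|} = Set.univ := by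
    ext x; simp
  rw [hs, Set.indicator_univ, integral_inner_sq_stdGaussian]
  calc n * ‖β‖ ^ 2 ≤ n * (σ * √((p : ℝ) / n)) ^ 2 := by gcongr
    _ = p * σ ^ 2 := by
        rw [mul_pow, Real.sq_sqrt (by positivity)]
        field_simp

/-- The contamination part of the lower bound. -/
lemma exists_dataLaw_error_ge_contamination {n : ℕ} (hn : 1 ≤ n) (hp : 1 ≤ p) {ε σ : ℝ}
    (hε : 0 < ε) (hε1 : ε ≤ 1) (hσ : 0 < σ)
    {βhat : (Fin n → EuclideanSpace ℝ (Fin p) × ℝ) → EuclideanSpace ℝ (Fin p)}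
    (hβhat : Measurable βhat) :
    ∃ (β : EuclideanSpace ℝ (Fin p)) (Q : Kernel (EuclideanSpace ℝ (Fin p)) ℝ),
      IsMarkovKernel Q ∧ 1 / 2 ≤ dataLaw n ε σ β Q {D | Real.exp (-12) *
        (σ * (ε / √(Real.log (n * ε ^ 2 / p + Real.exp 1))) / 12) ≤ ‖βhat D - β‖} := by
  have hn' : (0 : ℝ) < n := by exact_mod_cast hn
  have hp' : (0 : ℝ) < p := by exact_mod_cast hp
  set Λ : ℝ := n * ε ^ 2 / p + Real.exp 1 with hΛ
  have hq : 0 < n * ε ^ 2 / p := by positivity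
  have hΛ0 : 0 < Λ := by positivity
  have hlog : 1 ≤ Real.log Λ := by
    rw [Real.le_log_iff_exp_le hΛ0]; linarith
  set s := √(Real.log Λ) with hs
  have hs2 : s ^ 2 = Real.log Λ := Real.sq_sqrt (by linarith)
  have hs0 : 0 < s := Real.sqrt_pos.2 (by linarith)
  have hR : 0 < σ * (ε / s) / 12 := by positivity
  refine exists_dataLaw_error_ge_of_truncated (α := ε / 6) hp hε.le hε1 hσ hR (by positivity)
    le_rfl (fun β hβ => ?_) hβhat
  -- The value `t = 2s` turns the tail factor into `e^{3/2}/Λ`, and the `12` in the radius makes `R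
  -- t` equal the hiding threshold `σε/6`.
  have htail := integral_indicator_inner_sq_stdGaussian_le (t := 2 * s) hR hβ (by positivity)
  have hRt : σ * (ε / s) / 12 * (2 * s) = σ * (ε / 6) := by field_simp; norm_num
  have hexp : Real.exp (3 / 2 - (2 * s) ^ 2 / 4) ≤ 9 * (p / (n * ε ^ 2)) := by
    rw [show (2 * s) ^ 2 / 4 = Real.log Λ by rw [← hs2]; ring, Real.exp_sub, Real.exp_log hΛ0,
      div_eq_mul_inv]
    have h1 : Real.exp (3 / 2) ≤ 9 := by
      have h2 : Real.exp (3 / 2) ≤ Real.exp 1 * Real.exp 1 := by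
        rw [← Real.exp_add]; exact Real.exp_le_exp.2 (by norm_num)
      nlinarith [Real.exp_one_lt_d9, Real.exp_pos 1]
    have h3 : Λ⁻¹ ≤ p / (n * ε ^ 2) := by
      rw [← inv_div]
      exact inv_anti₀ hq (by linarith [Real.exp_pos 1])
    gcongr
  rw [hRt] at htail
  calc _ ≤ n * ((σ * (ε / s) / 12) ^ 2 * (4 * (9 * (p / (n * ε ^ 2))))) := by
        refine mul_le_mul_of_nonneg_left (htail.trans ?_) hn'.le
        gcongr
    _ = p * σ ^ 2 * (1 / (4 * s ^ 2)) := by field_simp; norm_num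
    _ ≤ p * σ ^ 2 * 1 := by
        gcongr
        rw [div_le_one (by positivity), hs2]
        linarith
    _ = p * σ ^ 2 := mul_one _

theorem theorem3p2 :
    ∃ C : ℝ, 0 < C ∧
      ∀ (n p : ℕ) (ε σ : ℝ), 1 ≤ n → 1 ≤ p → 0 ≤ ε → ε ≤ 1 → 0 < σ →
        (1 / 2 : ENNReal) ≤
          ⨅ (βhat : (Fin n → EuclideanSpace ℝ (Fin p) × ℝ) → EuclideanSpace ℝ (Fin p))
            (_ : Measurable βhat),
          ⨆ (β : EuclideanSpace ℝ (Fin p)) (Q : Kernel (EuclideanSpace ℝ (Fin p)) ℝ)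
            (_ : IsMarkovKernel Q),
            dataLaw n ε σ β Q {D | C * minimaxRate n p ε σ ≤ ‖βhat D - β‖} := by
  -- The factor `24 = 2 · 12`: the sum of two rates is at most twice the larger, and the
  -- contamination radius carries `1/12`.
  refine ⟨Real.exp (-12) / 24, by positivity, fun n p ε σ hn hp hε hε1 hσ =>
    le_iInf₂ fun βhat hβhat => ?_⟩
  obtain ⟨ρ, hρ, β, Q, hQ, h⟩ : ∃ ρ : ℝ, Real.exp (-12) / 24 * minimaxRate n p ε σ ≤ ρ ∧
      ∃ (β : EuclideanSpace ℝ (Fin p)) (Q : Kernel (EuclideanSpace ℝ (Fin p)) ℝ),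
        IsMarkovKernel Q ∧ 1 / 2 ≤ dataLaw n ε σ β Q {D | ρ ≤ ‖βhat D - β‖} := by
    have he := Real.exp_pos (-12)
    have hp0 : 0 ≤ σ * √((p : ℝ) / n) := by positivity
    rcases le_or_gt (σ * (ε / √(Real.log (n * ε ^ 2 / p + Real.exp 1)))) (σ * √((p : ℝ) / n))
      with hle | hlt
    · refine ⟨_, ?_, exists_dataLaw_error_ge_parametric hn hp hε hε1 hσ hβhat⟩
      rw [minimaxRate, mul_add]
      nlinarith
    · have hε0 : 0 < ε := by
        refine hε.lt_of_ne fun h0 => ?_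
        rw [← h0, zero_div, mul_zero] at hlt
        exact hlt.not_ge hp0
      refine ⟨_, ?_, exists_dataLaw_error_ge_contamination hn hp hε0 hε1 hσ hβhat⟩
      rw [minimaxRate, mul_add]
      nlinarith
  calc (1 / 2 : ENNReal) ≤ dataLaw n ε σ β Q {D | ρ ≤ ‖βhat D - β‖} := h
    _ ≤ dataLaw n ε σ β Q {D | Real.exp (-12) / 24 * minimaxRate n p ε σ ≤ ‖βhat D - β‖} :=
        measure_mono fun D hD => hρ.trans hD
    _ ≤ _ := by
        refine le_iSup_of_le β (le_iSup_of_le Q ?_)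
        rw [iSup_pos hQ]
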